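/- Let $R$ be an associative ring with unity and let $G$ be a subgroup of the group of units $R^*$. An equation over $R$ in unknowns $x_1,\dots,x_m$ is a finite formal expression $\sum_i\prod_j c_{ij}x_{ij}^{k_{ij}}=0$ with coefficients $c_{ij}\in R$, $x_{ij}\in\{x_1,\dots,x_m\}$ and $k_{ij}\in\mathbb Z$; a system is a (not necessarily finite) set of such equations. A system is called generalised homogeneous modulo an integer $n\ge 0$ if there is a map $\deg\colon\{x_1,\dots,x_m\}\to\mathbb Z/n\mathbb Z$ whose values generate the group $\mathbb Z/n\mathbb Z$ and such that, in each equation of the system, the degree $\sum_j k_{ij}\deg(x_{ij})\in\mathbb Z/n\mathbb Z$ of the $i$-th monomial does not depend on $i$ (it may depend on the equation). The homogeneity modulus $n_0$ of the system is the largest $n$ such that the system is generalised homogeneous modulo $n$, or $0$ if there are infinitely many such $n$. For a group $K$ and an integer $n\ge 0$ let $\mathrm{GCD}(K,n)$ be the least common multiple of the orders of all subgroups of $K$ whose order divides $n$. Divisibility is understood in the sense of cardinal arithmetic: a cardinal $a$ divides a cardinal $b$ if $b=a\cdot c$ for some cardinal $c$ (so an infinite cardinal is divisible by all nonzero cardinals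 not exceeding it, and $0$ is divisible by all cardinals and divides only $0$); the least common multiple of a set of nonzero cardinals is its least nonzero common multiple. In particular, $\mathrm{GCD}(K,0)=|K|$, and $\mathrm{GCD}(K,n)$ is the usual greatest common divisor of $|K|$ and $n$ if $K$ is finite. **Theorem.** For each system of equations over $R$ in $m$ unknowns, the number (cardinality of the set) of its solutions lying in $G^m$ is divisible by $\mathrm{GCD}(G_0,n_0)$, where $n_0$ is the homogeneity modulus of the system and $G_0$ is the subgroup of all elements of $G$ that commute with all coefficients of the system. -/

import Mathlib

universe u

/-- A factor `c * x_i ^ k` of a monomial: a coefficient `c` from the ring, one of the unknowns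
`x_0, …, x_{m-1}`, and an integer exponent `k`. -/
structure RingFactor (R : Type u) (m : ℕ) where
  coeff : R
  unknown : Fin m
  exponent : ℤ

/-- A (noncommutative) monomial `∏ j, c_j * x_j ^ k_j`, as a formal ordered product. -/
abbrev RingMonomial (R : Type u) (m : ℕ) := List (RingFactor R m)

/-- An equation `∑ i, ∏ j, c_ij * x_ij ^ k_ij = 0`; the list is the list of the terms of the
formal finite sum on the left-hand side. -/
abbrev RingEquation (R : Type u) (m : ℕ) := List (RingMonomial R m)

/-- A (not necessarily finite) system of equations over `R` in `m` unknowns. -/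
abbrev RingSystem (R : Type u) (m : ℕ) := Set (RingEquation R m)

namespace RingMonomial

variable {R : Type u} {m : ℕ}

/-- The value of a monomial at a tuple of units. -/
def eval [Ring R] (t : RingMonomial R m) (x : Fin m → Rˣ) : R :=
  (t.map fun f => f.coeff * ((x f.unknown ^ f.exponent : Rˣ) : R)).prod

/-- The degree `∑ j, k_j * deg x_j` of a monomial, for degrees of the unknowns in `ℤ/nℤ`. -/
def degree {n : ℕ} (t : RingMonomial R m) (deg : Fin m → ZMod n) : ZMod n :=
  (t.map fun f => (f.exponent : ZMod n) * deg f.unknown).sum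

end RingMonomial

/-- The value of the left-hand side of an equation at a tuple of units. -/
def RingEquation.eval {R : Type u} [Ring R] {m : ℕ} (e : RingEquation R m)
    (x : Fin m → Rˣ) : R :=
  (e.map fun t => RingMonomial.eval t x).sum

namespace RingSystem

variable {R : Type u} {m : ℕ}

/-- The set of all coefficients occurring in the system. -/
def coeffs (S : RingSystem R m) : Set R :=
  {c | ∃ e ∈ S, ∃ t ∈ e, ∃ f ∈ t, f.coeff = c}

/-- The set of the solutions of the system lying in `G ^ m`. -/
def solutions [Ring R] (S : RingSystem R m) (G : Subgroup Rˣ) : Set (Fin m → G) :=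
  {x | ∀ e ∈ S, RingEquation.eval e (fun i => (x i : Rˣ)) = 0}

/-- The system is generalised homogeneous modulo `n`: for some degrees of the unknowns in `ℤ/nℤ`,
which generate `ℤ/nℤ`, in each equation all monomials have the same degree (which may depend on the
equation). -/
def IsHomogeneousMod (S : RingSystem R m) (n : ℕ) : Prop :=
  ∃ deg : Fin m → ZMod n, AddSubgroup.closure (Set.range deg) = ⊤ ∧
    ∀ e ∈ S, ∃ d : ZMod n, ∀ t ∈ e, RingMonomial.degree t deg = d

open Classical in
/-- The homogeneity modulus: the largest `n` such that the system is generalised homogeneous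
modulo `n`, or zero if there are infinitely many such `n`. -/
noncomputable def homogeneityModulus (S : RingSystem R m) : ℕ :=
  if {n | S.IsHomogeneousMod n}.Finite then sSup {n | S.IsHomogeneousMod n} else 0

end RingSystem

/-- The least common multiple of a set of cardinals: the least nonzero common multiple (zero, if
there is no nonzero common multiple). -/
noncomputable def cardinalLCM (A : Set Cardinal.{u}) : Cardinal.{u} :=
  sInf {c | c ≠ 0 ∧ ∀ a ∈ A, a ∣ c}

/-- `GCD(G, n)` for a group `G` and an integer `n ≥ 0`: the least common multiple of the orders of
those subgroups of `G` whose order divides `n`, in the sense of cardinal arithmetic. -/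
noncomputable def groupGCD (G : Type u) [Group G] (n : ℕ) : Cardinal.{u} :=
  cardinalLCM {a | ∃ H : Subgroup G, a = Cardinal.mk H ∧ a ∣ (n : Cardinal.{u})}

/-! A solution in G^m is a homomorphism φ from the free group F to Rˣ sending the generators into G.
A grading modulo n = n₀ gives a surjection F → ℤ/n; let N be its kernel and t an element of degree
1. By `groupGCD_dvd` it suffices to treat one subgroup H of G₀ whose order divides n.

H acts on solutions by conjugation. Besides this, φ may be twisted into ψ that agrees with it on N
and differs from it by values in the core, the largest subgroup of H normalised by φ(F). By
`RingMonomial.eval_twist` this multiplies a monomial with word w on the right by φ(w)⁻¹ψ(w). The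
words of one equation are congruent modulo N, so this factor is common to its monomials and
solutions stay solutions.

A twist is determined by c = φ(t)⁻¹ψ(t), which lies in C, the centraliser of φ(N) in the core. Every
c in C occurs, because (φ(t)c)^n = φ(t)^n by `Subgroup.mul_pow_eq_pow_of_card_dvd`. The stabiliser
in H of the twist class of φ is also C (`twistRel_conj_iff`). Classes being equipotent to their
stabilisers, a Burnside count (`mk_group_dvd_mk_of_setoid`) gives |H| times the number of orbits of
classes. -/

open Cardinal

/-! ### Counting by orbits, and powers on a coset -/

/-- If a group acts on a set compatibly with an equivalence relation, and the class of each point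
is equipotent to the stabiliser of that class, then the order of the group divides the cardinality
of the set. -/
theorem mk_group_dvd_mk_of_setoid {H X : Type u} [Group H] [MulAction H X] (r : Setoid X)
    (hr : ∀ (h : H) {a b : X}, r a b → r (h • a) (h • b))
    (hcard : ∀ a : X, #{b : X // r b a} = #{h : H // r (h • a) a}) : #H ∣ #X := by
  classical
  let _ : MulAction H (Quotient r) :=
    { smul := fun h => Quotient.map (h • ·) fun _ _ hab => hr h hab
      one_smul := by
        rintro ⟨a⟩
        exact congrArg (Quotient.mk r) (one_smul H a)
      mul_smul := by
        rintro g h ⟨a⟩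
        exact congrArg (Quotient.mk r) (mul_smul g h a) }
  have hfib : ∀ q : Quotient r,
      #{b : X // Quotient.mk r b = q} = #(MulAction.stabilizer H q) := by
    rintro ⟨a⟩
    have h1 : #{b : X // Quotient.mk r b = Quotient.mk r a} = #{b : X // r b a} :=
      Cardinal.mk_congr (Equiv.subtypeEquivRight fun b => Quotient.eq)
    have h2 : #(MulAction.stabilizer H (Quotient.mk r a)) = #{h : H // r (h • a) a} :=
      Cardinal.mk_congr (Equiv.subtypeEquivRight fun h => by
        rw [MulAction.mem_stabilizer_iff]
        exact Quotient.eq)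
    exact h1.trans ((hcard a).trans h2.symm)
  -- Burnside's double count of the pairs (class, element fixing it); being a bijection, it also
  -- serves infinite cardinals.
  let e : (Σ q : Quotient r, MulAction.stabilizer H q) ≃
      Σ h : H, MulAction.fixedBy (Quotient r) h :=
    { toFun := fun p => ⟨p.2.1, p.1, p.2.2⟩
      invFun := fun p => ⟨p.2.1, p.1, p.2.2⟩
      left_inv := fun _ => rfl
      right_inv := fun _ => rfl }
  have key : #X = #(Quotient (MulAction.orbitRel H (Quotient r)) × H) := by
    rw [← Cardinal.mk_congr (Equiv.sigmaFiberEquiv (Quotient.mk r)),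
      ← Cardinal.mk_congr (MulAction.sigmaFixedByEquivOrbitsProdGroup H (Quotient r)),
      ← Cardinal.mk_congr e, Cardinal.mk_sigma, Cardinal.mk_sigma]
    exact congrArg Cardinal.sum (funext hfib)
  rw [key, Cardinal.mk_prod, Cardinal.lift_id, Cardinal.lift_id]
  exact Dvd.intro_left _ rfl

/-- A number dividing the lengths of all cycles of a permutation divides the number of points. -/
theorem Equiv.Perm.dvd_card_of_dvd_minimalPeriod {X : Type*} [Finite X] (π : Equiv.Perm X) {d : ℕ}
    (hd : ∀ x, d ∣ Function.minimalPeriod π x) : d ∣ Nat.card X := by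
  classical
  have := Fintype.ofFinite X
  rw [Nat.card_congr (MulAction.selfEquivSigmaOrbits (Subgroup.zpowers π) X), Nat.card_sigma]
  refine Finset.dvd_sum fun ω _ => ?_
  have h := MulAction.minimalPeriod_eq_card (a := π) (b := ω.out)
  rw [Nat.card_eq_fintype_card, ← h]
  exact hd _

/-- If `x` normalises a finite subgroup `C` whose order divides `n`, and `x ^ n` centralises `C`,
then the `n`-th power is constant on the coset `x C`. -/
theorem Subgroup.mul_pow_eq_pow_of_card_dvd {U : Type*} [Group U] (C : Subgroup U) [Finite C]
    {n : ℕ} (hn : n ≠ 0) (hC : Nat.card C ∣ n) {x : U} (hx : ∀ c ∈ C, x⁻¹ * c * x ∈ C)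
    (hxn : ∀ c ∈ C, Commute (x ^ n) c) {c : U} (hc : c ∈ C) : (x * c) ^ n = x ^ n := by
  have hconj : ∀ (k : ℕ), ∀ u ∈ C, (x ^ k)⁻¹ * u * (x * c) ^ k ∈ C := by
    intro k
    induction k with
    | zero => intro u hu; simpa using hu
    | succ k ih =>
      intro u hu
      have : (x ^ (k + 1))⁻¹ * u * (x * c) ^ (k + 1)
          = x⁻¹ * ((x ^ k)⁻¹ * u * (x * c) ^ k) * x * c := by
        rw [pow_succ, pow_succ]; group
      rw [this]
      exact C.mul_mem (hx _ (ih u hu)) hc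
  -- The k-th iterate of this permutation compares x ^ k with (x c) ^ k, so its cycle lengths
  -- control z = x⁻ⁿ(xc)ⁿ.
  let f : C → C := fun u => ⟨x⁻¹ * u * (x * c), by simpa using hconj 1 u u.2⟩
  have hf : Function.Injective f := by
    intro u v h
    have h' := congrArg Subtype.val h
    exact Subtype.ext (by simpa [f] using h')
  let π : Equiv.Perm C := Equiv.ofBijective f (Finite.injective_iff_bijective.mp hf)
  have hπ : ∀ (k : ℕ) (u : C), ((π^[k] u : C) : U) = (x ^ k)⁻¹ * u * (x * c) ^ k := by
    intro k u
    induction k with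
    | zero => simp
    | succ k ih =>
      rw [Function.iterate_succ_apply']
      change x⁻¹ * ((π^[k] u : C) : U) * (x * c) = _
      rw [ih, pow_succ, pow_succ]; group
  set y := x * c with hy
  set z := (x ^ n)⁻¹ * y ^ n with hz
  have hzC : z ∈ C := by simpa [hz] using hconj n 1 C.one_mem
  have hxy : Commute (x ^ n) y := ((Commute.refl x).pow_left n).mul_right (hxn c hc)
  have hcomm : ∀ c ∈ C, ∀ r : ℕ, Commute (x ^ (n * r)) c := fun c hc r => by
    rw [pow_mul]; exact (hxn c hc).pow_left r
  have hzr : ∀ r : ℕ, z ^ r = (x ^ (n * r))⁻¹ * y ^ (n * r) := by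
    intro r
    rw [hz, ((hxy.pow_right n).inv_left).mul_pow, pow_mul, pow_mul, inv_pow]
  -- The order of z is shown to be prime to each p separately.
  have hord : ∀ p : ℕ, p.Prime → ∃ r, ¬ p ∣ r ∧ z ^ r = 1 := by
    intro p hp
    have hcard : Nat.card C ≠ 0 := Nat.card_pos.ne'
    -- Otherwise a power of p too large to divide n would divide |C|.
    obtain ⟨u, hu⟩ : ∃ u : C, ¬ p ^ (n.factorization p + 1) ∣ Function.minimalPeriod π u := by
      by_contra! hall
      have := (π.dvd_card_of_dvd_minimalPeriod hall).trans hC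
      exact Nat.pow_succ_factorization_not_dvd hn hp this
    set k := Function.minimalPeriod π u with hk
    have hk0 : k ≠ 0 := by rintro h; rw [h] at hu; exact hu (dvd_zero _)
    have hku : u = (x ^ k)⁻¹ * u * y ^ k := by
      rw [← hπ k u, hk, Function.iterate_minimalPeriod]
    have hpow : ∀ s : ℕ, (x ^ (k * s)) * u = u * y ^ (k * s) := by
      have h1 : x ^ k * u = u * y ^ k := by
        nth_rewrite 1 [hku]; group
      intro s
      have : SemiconjBy (u : U) (y ^ k) (x ^ k) := h1.symm
      have h2 := this.pow_right s
      rw [pow_mul, pow_mul]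
      exact h2.eq.symm
    -- As k contains p to no higher power than n does, lcm(n, k) = n r with r prime to p. Its
    -- multiplicity in k closes the cycle of u, its multiplicity in n makes the power of x central
    -- for C; together they give z ^ r = 1.
    obtain ⟨r, hr⟩ := Nat.dvd_lcm_left n k
    obtain ⟨s, hs⟩ := Nat.dvd_lcm_right n k
    refine ⟨r, ?_, ?_⟩
    · intro hpr
      have hdvd : p ^ (n.factorization p + 1) ∣ n.lcm k := by
        rw [hr, pow_succ]
        exact mul_dvd_mul (Nat.ordProj_dvd n p) hpr
      have hl0 : n.lcm k ≠ 0 := Nat.lcm_ne_zero hn hk0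
      rw [hp.pow_dvd_iff_le_factorization hl0, Nat.factorization_lcm hn hk0] at hdvd
      rw [hp.pow_dvd_iff_le_factorization hk0] at hu
      simp only [Finsupp.sup_apply] at hdvd
      omega
    · have h3 := hpow s
      rw [← hs, hr] at h3
      rw [(hcomm u u.2 r).eq] at h3
      rw [hzr r, ← mul_left_cancel h3]
      group
  have hz1 : z = 1 := by
    rw [← orderOf_eq_one_iff]
    by_contra hne
    obtain ⟨p, hp, hpd⟩ := Nat.exists_prime_and_dvd hne
    obtain ⟨r, hpr, hr⟩ := hord p hp
    exact hpr (hpd.trans (orderOf_dvd_of_pow_eq_one hr))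
  rw [hz, inv_mul_eq_one] at hz1
  exact hz1.symm

/-! ### Twisting homomorphisms along a cyclic quotient -/

section HomDivisibility

variable {F : Type} {U : Type u} [Group F] [Group U]

/-- The largest subgroup of `H` normalised by the image of `φ`. -/
def homCore (H : Subgroup U) (φ : F →* U) : Subgroup U :=
  ⨅ f, H.comap (MulAut.conj (φ f)).toMonoidHom

theorem mem_homCore {H : Subgroup U} {φ : F →* U} {u : U} :
    u ∈ homCore H φ ↔ ∀ f, φ f * u * (φ f)⁻¹ ∈ H := by
  simp [homCore, Subgroup.mem_iInf]

theorem homCore_le (H : Subgroup U) (φ : F →* U) : homCore H φ ≤ H := fun u hu => by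
  simpa using mem_homCore.mp hu 1

theorem conj_mem_homCore {H : Subgroup U} {φ : F →* U} {u : U} (hu : u ∈ homCore H φ) (f : F) :
    φ f * u * (φ f)⁻¹ ∈ homCore H φ := by
  rw [mem_homCore] at hu ⊢
  intro g
  simpa [mul_assoc] using hu (g * f)

theorem inv_conj_mem_homCore {H : Subgroup U} {φ : F →* U} {u : U} (hu : u ∈ homCore H φ)
    (f : F) : (φ f)⁻¹ * u * φ f ∈ homCore H φ := by
  simpa using conj_mem_homCore hu f⁻¹

/-- Two homomorphisms agree on `N` and modulo the core of `H`. -/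
def TwistRel (H : Subgroup U) (N : Subgroup F) (φ ψ : F →* U) : Prop :=
  (∀ f ∈ N, φ f = ψ f) ∧ ∀ f, (φ f)⁻¹ * ψ f ∈ homCore H φ

namespace TwistRel

variable {H : Subgroup U} {N : Subgroup F} {φ ψ χ : F →* U}

theorem refl (φ : F →* U) : TwistRel H N φ φ :=
  ⟨fun _ _ => rfl, fun f => by simp⟩

/-- Writing ψ f = φ f · a with a in the core, conjugation by ψ f is conjugation by a followed by
conjugation by φ f. With symmetry, the core depends only on the class. -/
theorem homCore_le (h : TwistRel H N φ ψ) : homCore H φ ≤ homCore H ψ := by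
  intro u hu
  rw [mem_homCore]
  intro f
  have ha := h.2 f
  have := mem_homCore.mp ((homCore H φ).mul_mem ((homCore H φ).mul_mem ha hu)
    ((homCore H φ).inv_mem ha)) f
  have e : φ f * ((φ f)⁻¹ * ψ f * u * ((φ f)⁻¹ * ψ f)⁻¹) * (φ f)⁻¹ = ψ f * u * (ψ f)⁻¹ := by
    group
  rwa [e] at this

theorem symm (h : TwistRel H N φ ψ) : TwistRel H N ψ φ :=
  ⟨fun f hf => (h.1 f hf).symm, fun f => by
    simpa using h.homCore_le ((homCore H φ).inv_mem (h.2 f))⟩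

theorem trans (h : TwistRel H N φ ψ) (h' : TwistRel H N ψ χ) : TwistRel H N φ χ :=
  ⟨fun f hf => (h.1 f hf).trans (h'.1 f hf), fun f => by
    simpa using (homCore H φ).mul_mem (h.2 f) (h.symm.homCore_le (h'.2 f))⟩

theorem conj (h : TwistRel H N φ ψ) {u : U} (hu : u ∈ H) :
    TwistRel H N ((MulAut.conj u).toMonoidHom.comp φ) ((MulAut.conj u).toMonoidHom.comp ψ) := by
  refine ⟨fun f hf => by simp [h.1 f hf], fun f => ?_⟩
  rw [mem_homCore]
  intro g
  have := H.mul_mem (H.mul_mem hu (mem_homCore.mp (h.2 f) g)) (H.inv_mem hu)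
  simpa [mul_assoc] using this

end TwistRel

/-- The elements of the core that centralise the image of `N`. -/
def coreCentralizer (H : Subgroup U) (N : Subgroup F) (φ : F →* U) : Subgroup U :=
  homCore H φ ⊓ Subgroup.centralizer (φ '' N)

theorem mem_coreCentralizer {H : Subgroup U} {N : Subgroup F} {φ : F →* U} {u : U} :
    u ∈ coreCentralizer H N φ ↔ u ∈ homCore H φ ∧ ∀ f ∈ N, φ f * u = u * φ f := by
  simp [coreCentralizer, Subgroup.mem_inf, Subgroup.mem_centralizer_iff]

theorem conj_mem_coreCentralizer {H : Subgroup U} {N : Subgroup F} [N.Normal] {φ : F →* U} {u : U}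
    (hu : u ∈ coreCentralizer H N φ) (f : F) :
    φ f * u * (φ f)⁻¹ ∈ coreCentralizer H N φ := by
  rw [mem_coreCentralizer] at hu ⊢
  refine ⟨conj_mem_homCore hu.1 f, fun g hg => ?_⟩
  have h1 := hu.2 (f⁻¹ * g * f) (by simpa using ‹N.Normal›.conj_mem g hg f⁻¹)
  simp only [map_mul, map_inv] at h1
  calc φ g * (φ f * u * (φ f)⁻¹) = φ f * ((φ f)⁻¹ * φ g * φ f * u) * (φ f)⁻¹ := by group
    _ = _ := by rw [h1]; group

theorem inv_conj_mem_coreCentralizer {H : Subgroup U} {N : Subgroup F} [N.Normal] {φ : F →* U}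
    {u : U} (hu : u ∈ coreCentralizer H N φ) (f : F) :
    (φ f)⁻¹ * u * φ f ∈ coreCentralizer H N φ := by
  simpa using conj_mem_coreCentralizer hu f⁻¹

/-- This computes the stabiliser of a class: agreement on N is the centralising condition, and the
commutators φ(f)uφ(f)⁻¹u⁻¹ lie in H exactly when all conjugates of u do. -/
theorem twistRel_conj_iff {H : Subgroup U} {N : Subgroup F} {φ : F →* U} {u : U} (hu : u ∈ H) :
    TwistRel H N φ ((MulAut.conj u).toMonoidHom.comp φ) ↔ u ∈ coreCentralizer H N φ := by
  rw [mem_coreCentralizer]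
  constructor
  · rintro ⟨h1, h2⟩
    refine ⟨?_, fun f hf => ?_⟩
    · rw [mem_homCore]
      intro f
      have := H.mul_mem (homCore_le H φ (h2 f⁻¹)) hu
      simpa [mul_assoc] using this
    · have := h1 f hf
      simp only [MonoidHom.comp_apply, MulEquiv.coe_toMonoidHom, MulAut.conj_apply] at this
      rw [eq_mul_inv_iff_mul_eq] at this
      exact this
  · rintro ⟨h1, h2⟩
    refine ⟨fun f hf => ?_, fun f => ?_⟩
    · simp [← h2 f hf]
    · have := (homCore H φ).mul_mem (inv_conj_mem_homCore h1 f) ((homCore H φ).inv_mem h1)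
      simpa [mul_assoc] using this

/-- If `x` normalises `C` and `c ∈ C`, then `(x c) ^ k ∈ x ^ k C`. -/
theorem Subgroup.inv_zpow_mul_mul_zpow_mem (C : Subgroup U) {x c : U}
    (hx : ∀ u ∈ C, x * u * x⁻¹ ∈ C) (hx' : ∀ u ∈ C, x⁻¹ * u * x ∈ C) (hc : c ∈ C) (k : ℤ) :
    (x ^ k)⁻¹ * (x * c) ^ k ∈ C := by
  induction k with
  | zero => simp [C.one_mem]
  | succ k ih =>
    have e : (x ^ ((k : ℤ) + 1))⁻¹ * (x * c) ^ ((k : ℤ) + 1)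
        = x⁻¹ * ((x ^ (k : ℤ))⁻¹ * (x * c) ^ (k : ℤ)) * x * c := by
      rw [zpow_add_one, zpow_add_one]; group
    rw [e]
    exact C.mul_mem (hx' _ ih) hc
  | pred k ih =>
    have e : (x ^ (-(k : ℤ) - 1))⁻¹ * (x * c) ^ (-(k : ℤ) - 1)
        = x * ((x ^ (-(k : ℤ)))⁻¹ * (x * c) ^ (-(k : ℤ)) * c⁻¹) * x⁻¹ := by
      rw [zpow_sub_one, zpow_sub_one]; group
    rw [e]
    exact hx _ (C.mul_mem ih (C.inv_mem hc))

variable {N : Subgroup F} [N.Normal] {t : F} {n : ℕ}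

/-- A homomorphism can be multiplied, at a generator `t` of the cyclic quotient by `N`, by any
element `c` of the core centralising the image of `N` with `(φ t * c) ^ n = φ t ^ n`. -/
theorem exists_twist {H : Subgroup U} {φ : F →* U} (ht : ∀ f, ∃ k : ℤ, f * (t ^ k)⁻¹ ∈ N)
    (hn : ∀ k : ℤ, t ^ k ∈ N → (n : ℤ) ∣ k) {c : U} (hc : c ∈ coreCentralizer H N φ)
    (hcn : (φ t * c) ^ n = φ t ^ n) : ∃ ψ : F →* U, TwistRel H N φ ψ ∧ ψ t = φ t * c := by
  choose d hd using ht
  set y := φ t * c with hy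
  have hmem : ∀ k : ℤ, (φ t ^ k)⁻¹ * y ^ k ∈ coreCentralizer H N φ :=
    Subgroup.inv_zpow_mul_mul_zpow_mem _ (fun u hu => conj_mem_coreCentralizer hu t)
      (fun u hu => inv_conj_mem_coreCentralizer hu t) hc
  -- The correction factor depends only on the exponent modulo n; this is where the equality of n-th
  -- powers enters.
  have hper : ∀ k l : ℤ, t ^ (k - l) ∈ N → (φ t ^ k)⁻¹ * y ^ k = (φ t ^ l)⁻¹ * y ^ l := by
    intro k l hkl
    obtain ⟨j, hj⟩ := hn _ hkl
    obtain rfl : k = n * j + l := by omega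
    rw [zpow_add, zpow_add, zpow_mul, zpow_mul, zpow_natCast, zpow_natCast, hcn]
    group
  have hval : ∀ (f : F) (k : ℤ), f * (t ^ k)⁻¹ ∈ N →
      φ f * ((φ t ^ d f)⁻¹ * y ^ d f) = φ f * ((φ t ^ k)⁻¹ * y ^ k) := by
    intro f k hk
    rw [hper (d f) k]
    have := N.mul_mem (N.inv_mem (hd f)) hk
    have e : (f * (t ^ d f)⁻¹)⁻¹ * (f * (t ^ k)⁻¹) = t ^ (d f - k) := by
      rw [zpow_sub]; group
    rwa [e] at this
  refine ⟨MonoidHom.mk' (fun f => φ f * ((φ t ^ d f)⁻¹ * y ^ d f)) ?_, ⟨?_, ?_⟩, ?_⟩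
  · intro f g
    have hfg : f * g * (t ^ (d f + d g))⁻¹ ∈ N := by
      have := N.mul_mem (hd f) (‹N.Normal›.conj_mem _ (hd g) (t ^ d f))
      have e : f * (t ^ d f)⁻¹ * (t ^ d f * (g * (t ^ d g)⁻¹) * (t ^ d f)⁻¹)
          = f * g * (t ^ (d f + d g))⁻¹ := by
        rw [zpow_add]; group
      rwa [e] at this
    change φ (f * g) * _ = _
    rw [hval (f * g) _ hfg]
    -- The N-part of g commutes with the correction factor of f, which makes the twisted map
    -- multiplicative.
    have h1 := (mem_coreCentralizer.mp (hmem (d f))).2 _ (hd g)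
    simp only [map_mul, map_inv, map_zpow] at h1 ⊢
    calc φ f * φ g * ((φ t ^ (d f + d g))⁻¹ * y ^ (d f + d g))
        = φ f * (φ g * (φ t ^ d g)⁻¹ * ((φ t ^ d f)⁻¹ * y ^ d f)) * y ^ d g := by
          rw [zpow_add, zpow_add, mul_inv_rev]
          simp only [mul_assoc]
      _ = _ := by rw [h1]; simp only [mul_assoc]
  · intro f hf
    change φ f = φ f * _
    rw [hval f 0 (by simpa using hf)]
    simp
  · intro f
    change (φ f)⁻¹ * (φ f * _) ∈ _
    rw [inv_mul_cancel_left]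
    exact (mem_coreCentralizer.mp (hmem (d f))).1
  · change φ t * _ = _
    rw [hval t 1 (by simp [N.one_mem])]
    simp

/-- The homomorphisms related to `φ` are as many as the elements of the core that centralise the
image of `N`. -/
theorem mk_twistRel {H : Subgroup U} (hH : #H ∣ (n : Cardinal.{u})) (φ : F →* U)
    (ht : ∀ f, ∃ k : ℤ, f * (t ^ k)⁻¹ ∈ N) (hn : ∀ k : ℤ, t ^ k ∈ N ↔ (n : ℤ) ∣ k) :
    #{ψ : F →* U // TwistRel H N φ ψ} = #(coreCentralizer H N φ) := by
  have hmem : ∀ ψ : F →* U, TwistRel H N φ ψ → (φ t)⁻¹ * ψ t ∈ coreCentralizer H N φ := by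
    intro ψ hψ
    rw [mem_coreCentralizer]
    refine ⟨hψ.2 t, fun f hf => ?_⟩
    have h1 := hψ.1 _ (‹N.Normal›.conj_mem f hf t)
    simp only [map_mul, map_inv, ← hψ.1 f hf] at h1
    calc φ f * ((φ t)⁻¹ * ψ t) = (φ t)⁻¹ * (φ t * φ f * (φ t)⁻¹) * ψ t := by group
      _ = _ := by rw [h1]; group
  refine Cardinal.mk_congr (Equiv.ofBijective (fun ψ => ⟨(φ t)⁻¹ * ψ.1 t, hmem ψ.1 ψ.2⟩) ⟨?_, ?_⟩)
  · rintro ⟨ψ, hψ⟩ ⟨χ, hχ⟩ h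
    have ht' : ψ t = χ t := by simpa using congrArg Subtype.val h
    refine Subtype.ext (MonoidHom.ext fun f => ?_)
    obtain ⟨k, hk⟩ := ht f
    have h1 := (hψ.1 _ hk).symm.trans (hχ.1 _ hk)
    simpa [ht'] using h1
  · rintro ⟨c, hc⟩
    obtain ⟨ψ, hψ, hψt⟩ := exists_twist ht (fun k => (hn k).mp) hc (by
      rcases eq_or_ne n 0 with rfl | hn0
      · simp
      have hdvd : #(coreCentralizer H N φ) ∣ (n : Cardinal.{u}) := by
        have hle : coreCentralizer H N φ ≤ H := inf_le_left.trans (homCore_le H φ)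
        refine dvd_trans ?_ hH
        rw [← Cardinal.mk_congr (Subgroup.subgroupOfEquivOfLe hle).toEquiv,
          Cardinal.mk_congr (Subgroup.groupEquivQuotientProdSubgroup
            (s := (coreCentralizer H N φ).subgroupOf H)), Cardinal.mk_prod]
        simp
      have hfin : Finite (coreCentralizer H N φ) := by
        rw [← Cardinal.lt_aleph0_iff_finite]
        exact (Cardinal.le_of_dvd (by exact_mod_cast hn0) hdvd).trans_lt Cardinal.natCast_lt_aleph0
      refine (coreCentralizer H N φ).mul_pow_eq_pow_of_card_dvd hn0 ?_
        (fun u hu => inv_conj_mem_coreCentralizer hu t) (fun u hu => ?_) hc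
      · rw [← Nat.cast_card] at hdvd
        exact Cardinal.nat_coe_dvd_iff.mp hdvd
      · have h1 : t ^ n ∈ N := by simpa using (hn n).mpr dvd_rfl
        have := (mem_coreCentralizer.mp hu).2 _ h1
        rwa [map_pow] at this)
    exact ⟨⟨ψ, hψ⟩, Subtype.ext (by simp [hψt])⟩

/-- A set of homomorphisms closed under conjugation by `H` and under twisting along a cyclic
quotient of order `n` has cardinality divisible by the order of `H`, if this order divides `n`. -/
theorem mk_subgroup_dvd_mk_homs {H : Subgroup U} (hH : #H ∣ (n : Cardinal.{u}))
    (ht : ∀ f, ∃ k : ℤ, f * (t ^ k)⁻¹ ∈ N) (hn : ∀ k : ℤ, t ^ k ∈ N ↔ (n : ℤ) ∣ k)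
    (Φ : Set (F →* U)) (hconj : ∀ u ∈ H, ∀ φ ∈ Φ, (MulAut.conj u).toMonoidHom.comp φ ∈ Φ)
    (htwist : ∀ φ ∈ Φ, ∀ ψ, TwistRel H N φ ψ → ψ ∈ Φ) : #H ∣ #Φ := by
  let _ : MulAction H Φ :=
    { smul := fun u φ => ⟨(MulAut.conj (u : U)).toMonoidHom.comp φ.1, hconj u u.2 _ φ.2⟩
      one_smul := fun φ => Subtype.ext (MonoidHom.ext fun f => by
        change MulAut.conj ((1 : H) : U) (φ.1 f) = φ.1 f
        simp)
      mul_smul := fun u v φ => Subtype.ext (MonoidHom.ext fun f => by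
        change MulAut.conj ((u * v : H) : U) (φ.1 f)
          = MulAut.conj (u : U) (MulAut.conj (v : U) (φ.1 f))
        simp) }
  let r : Setoid Φ :=
    { r := fun φ ψ => TwistRel H N φ.1 ψ.1
      iseqv := ⟨fun φ => .refl φ.1, .symm, .trans⟩ }
  refine mk_group_dvd_mk_of_setoid r (fun u _ _ h => h.conj u.2) fun φ => ?_
  trans #(coreCentralizer H N φ.1)
  · rw [← mk_twistRel hH φ.1 ht hn]
    exact Cardinal.mk_congr
      { toFun := fun ψ => ⟨ψ.1.1, ψ.2.symm⟩
        invFun := fun ψ => ⟨⟨ψ.1, htwist _ φ.2 _ ψ.2⟩, ψ.2.symm⟩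
        left_inv := fun _ => rfl
        right_inv := fun _ => rfl }
  · have key : ∀ u : H, r (u • φ) φ ↔ (u : U) ∈ coreCentralizer H N φ.1 := fun u =>
      r.comm'.trans (twistRel_conj_iff u.2)
    exact Cardinal.mk_congr
      { toFun := fun u => ⟨⟨u.1, homCore_le H φ.1 (mem_coreCentralizer.mp u.2).1⟩,
          (key _).mpr u.2⟩
        invFun := fun u => ⟨u.1.1, (key _).mp u.2⟩
        left_inv := fun _ => rfl
        right_inv := fun _ => rfl }

end HomDivisibility

/-! ### Gradings and the homogeneity modulus -/

/-- An infinite finitely generated abelian group has an infinite cyclic quotient. -/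
theorem exists_surjective_int_of_infinite (Q : Type*) [AddCommGroup Q] [Module.Finite ℤ Q]
    [Infinite Q] : ∃ f : Q →ₗ[ℤ] ℤ, Function.Surjective f := by
  have hnt : Nontrivial (Q ⧸ Submodule.torsion ℤ Q) := by
    by_contra h
    rw [not_nontrivial_iff_subsingleton, Submodule.Quotient.subsingleton_iff] at h
    have : Module.IsTorsion ℤ Q := (Submodule.isTorsion'_iff_torsion'_eq_top _).mpr h
    exact not_finite_iff_infinite.mpr ‹_› (Module.finite_of_fg_torsion Q this)
  have hfree : Module.Free ℤ (Q ⧸ Submodule.torsion ℤ Q) := inferInstance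
  let b := Module.Free.chooseBasis ℤ (Q ⧸ Submodule.torsion ℤ Q)
  have : Nonempty (Module.Free.ChooseBasisIndex ℤ (Q ⧸ Submodule.torsion ℤ Q)) :=
    b.index_nonempty
  obtain ⟨i⟩ := this
  refine ⟨(b.coord i).comp (Submodule.torsion ℤ Q).mkQ, ?_⟩
  rw [LinearMap.coe_comp]
  refine Function.Surjective.comp (fun k => ⟨k • b i, by simp⟩) (Submodule.mkQ_surjective _)

section Degrees

variable {R : Type u} {m : ℕ}

/-- The vector of the total exponents of the unknowns in a monomial. -/
def RingMonomial.totalExponents (t : RingMonomial R m) : Fin m → ℤ :=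
  (t.map fun f => Pi.single f.unknown f.exponent).sum

theorem RingMonomial.degree_eq_linearCombination {n : ℕ} (t : RingMonomial R m)
    (deg : Fin m → ZMod n) :
    t.degree deg = Fintype.linearCombination ℤ deg t.totalExponents := by
  induction t with
  | nil => simp [RingMonomial.degree, RingMonomial.totalExponents]
  | cons f t ih =>
    simp only [RingMonomial.degree, RingMonomial.totalExponents, List.map_cons, List.sum_cons,
      map_add] at ih ⊢
    rw [ih, Fintype.linearCombination_apply_single, zsmul_eq_mul]

namespace RingSystem

/-- The exponent vectors that have degree zero for every grading of the system. -/
def relationModule (S : RingSystem R m) : Submodule ℤ (Fin m → ℤ) :=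
  Submodule.span ℤ {v | ∃ e ∈ S, ∃ s ∈ e, ∃ t ∈ e,
    v = RingMonomial.totalExponents s - RingMonomial.totalExponents t}

theorem closure_range_eq_top_iff {n : ℕ} (deg : Fin m → ZMod n) :
    AddSubgroup.closure (Set.range deg) = ⊤ ↔
      Function.Surjective (Fintype.linearCombination ℤ deg) := by
  rw [← LinearMap.range_eq_top, Fintype.range_linearCombination,
    ← Submodule.toAddSubgroup_inj, Submodule.span_int_eq_addSubgroupClosure]
  rfl

/-- A grading is a linear map on ℤ^m killing the differences of exponent vectors within each
equation. With the converse below, the moduli are the n for which ℤ/n is a quotient of one fixed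
finitely generated abelian group. -/
theorem IsHomogeneousMod.exists_surjective {S : RingSystem R m} {n : ℕ}
    (h : S.IsHomogeneousMod n) :
    ∃ f : ((Fin m → ℤ) ⧸ S.relationModule) →ₗ[ℤ] ZMod n, Function.Surjective f := by
  obtain ⟨deg, hdeg, hS⟩ := h
  have hker : S.relationModule ≤ LinearMap.ker (Fintype.linearCombination ℤ deg) := by
    refine Submodule.span_le.mpr fun v hv => ?_
    obtain ⟨e, he, s, hs, t, ht, rfl⟩ := hv
    obtain ⟨d, hd⟩ := hS e he
    rw [SetLike.mem_coe, LinearMap.mem_ker, map_sub, ← RingMonomial.degree_eq_linearCombination,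
      ← RingMonomial.degree_eq_linearCombination, hd s hs, hd t ht, sub_self]
  refine ⟨S.relationModule.liftQ (Fintype.linearCombination ℤ deg) hker, fun a => ?_⟩
  obtain ⟨v, hv⟩ := (closure_range_eq_top_iff deg).mp hdeg a
  exact ⟨S.relationModule.mkQ v, hv⟩

theorem isHomogeneousMod_of_surjective {S : RingSystem R m} {n : ℕ}
    (f : ((Fin m → ℤ) ⧸ S.relationModule) →ₗ[ℤ] ZMod n) (hf : Function.Surjective f) :
    S.IsHomogeneousMod n := by
  let deg : Fin m → ZMod n := fun j => f (S.relationModule.mkQ (Pi.single j 1))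
  have key : Fintype.linearCombination ℤ deg = f.comp S.relationModule.mkQ := by
    refine (Pi.basisFun ℤ (Fin m)).ext fun j => ?_
    simp [deg, Fintype.linearCombination_apply_single]
  refine ⟨deg, ?_, fun e he => ?_⟩
  · rw [closure_range_eq_top_iff, key]
    exact hf.comp (Submodule.mkQ_surjective _)
  · rcases e with _ | ⟨s, e⟩
    · exact ⟨0, by simp⟩
    · refine ⟨RingMonomial.degree s deg, fun t ht => ?_⟩
      rw [RingMonomial.degree_eq_linearCombination, RingMonomial.degree_eq_linearCombination,
        key, LinearMap.comp_apply, LinearMap.comp_apply]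
      congr 1
      exact (Submodule.Quotient.eq _).mpr
        (Submodule.subset_span ⟨_, he, t, ht, s, by simp, rfl⟩)

theorem isHomogeneousMod_one (S : RingSystem R m) : S.IsHomogeneousMod 1 :=
  ⟨0, Subsingleton.elim _ _, fun _ _ => ⟨0, fun _ _ => Subsingleton.elim _ _⟩⟩

theorem isHomogeneousMod_homogeneityModulus (S : RingSystem R m) :
    S.IsHomogeneousMod S.homogeneityModulus := by
  classical
  unfold homogeneityModulus
  split_ifs with hfin
  · exact Nat.sSup_mem ⟨1, S.isHomogeneousMod_one⟩ hfin.bddAbove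
  -- If the quotient were finite, its order would bound all moduli. Being infinite, it maps onto ℤ,
  -- which is `ZMod 0`.
  · have : Infinite ((Fin m → ℤ) ⧸ S.relationModule) := by
      by_contra hQ
      rw [not_infinite_iff_finite] at hQ
      refine hfin ((Set.finite_Iic (Nat.card ((Fin m → ℤ) ⧸ S.relationModule))).subset ?_)
      intro n hn
      obtain ⟨f, hf⟩ := IsHomogeneousMod.exists_surjective hn
      simpa using Nat.card_le_card_of_surjective f hf
    obtain ⟨f, hf⟩ := exists_surjective_int_of_infinite ((Fin m → ℤ) ⧸ S.relationModule)
    exact isHomogeneousMod_of_surjective (n := 0) f hf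

end RingSystem

end Degrees

/-! ### Least common multiples of cardinals -/

theorem Subgroup.mk_dvd_mk {K : Type u} [Group K] (H : Subgroup K) : #H ∣ #K := by
  rw [Cardinal.mk_congr (Subgroup.groupEquivQuotientProdSubgroup (s := H)), Cardinal.mk_prod]
  simp

/-- The greatest common divisor of a group and an integer divides every cardinal that is divisible
by the orders of the subgroups whose order divides this integer. -/
theorem groupGCD_dvd {K : Type u} [Group K] {n : ℕ} {c : Cardinal.{u}}
    (h : ∀ H : Subgroup K, #H ∣ (n : Cardinal.{u}) → #H ∣ c) : groupGCD K n ∣ c := by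
  set A : Set Cardinal.{u} := {a | ∃ H : Subgroup K, a = #H ∧ a ∣ (n : Cardinal.{u})} with hA
  set M : Set Cardinal.{u} := {c | c ≠ 0 ∧ ∀ a ∈ A, a ∣ c} with hM
  change sInf M ∣ c
  rcases eq_or_ne n 0 with rfl | hn
  -- Every order divides 0, so K itself is admitted and the least common multiple is its order.
  · have htop : #K ∈ A := ⟨⊤, Cardinal.mk_congr Subgroup.topEquiv.symm.toEquiv, by simp⟩
    have hK : #K ∈ M := by
      refine ⟨Cardinal.mk_ne_zero K, ?_⟩
      rintro _ ⟨H, rfl, -⟩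
      exact H.mk_dvd_mk
    have hinf : sInf M = #K := by
      refine le_antisymm (csInf_le' hK) (le_csInf ⟨_, hK⟩ ?_)
      rintro b ⟨hb0, hb⟩
      exact Cardinal.le_of_dvd hb0 (hb _ htop)
    rw [hinf]
    obtain ⟨H, hH, hdvd⟩ := htop
    rw [hH] at hdvd ⊢
    exact h H hdvd
  · have hnM : (n : Cardinal.{u}) ∈ M := ⟨by exact_mod_cast hn, fun a ⟨_, _, ha⟩ => ha⟩
    have hmem : sInf M ∈ M := csInf_mem ⟨_, hnM⟩
    rcases eq_or_ne c 0 with rfl | hc0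
    · exact dvd_zero _
    have hcM : c ∈ M := ⟨hc0, by rintro _ ⟨H, rfl, ha⟩; exact h H ha⟩
    rcases le_or_gt ℵ₀ c with hc | hc
    · exact Cardinal.dvd_of_le_of_aleph0_le hmem.1 (csInf_le' hcM) hc
    · obtain ⟨k, rfl⟩ := Cardinal.lt_aleph0.mp hc
      have hlt : sInf M < ℵ₀ := (csInf_le' hcM).trans_lt hc
      obtain ⟨l, hl⟩ := Cardinal.lt_aleph0.mp hlt
      rw [hl] at hmem ⊢
      have hl0 : l ≠ 0 := by exact_mod_cast hmem.1
      -- In the finite case the gcd of the least common multiple l and the common multiple k is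
      -- again a common multiple, so by minimality it is l.
      have hg : ((Nat.gcd l k : ℕ) : Cardinal.{u}) ∈ M := by
        refine ⟨by exact_mod_cast Nat.gcd_ne_zero_left hl0, fun a ha => ?_⟩
        have ha_lt : a < ℵ₀ := (Cardinal.le_of_dvd hc0 (hcM.2 a ha)).trans_lt hc
        obtain ⟨i, rfl⟩ := Cardinal.lt_aleph0.mp ha_lt
        exact Cardinal.nat_coe_dvd_iff.mpr (Nat.dvd_gcd
          (Cardinal.nat_coe_dvd_iff.mp (hmem.2 _ ha)) (Cardinal.nat_coe_dvd_iff.mp (hcM.2 _ ha)))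
      have hle : l ≤ Nat.gcd l k := by
        have := csInf_le' hg
        rw [hl] at this
        exact_mod_cast this
      have heq : Nat.gcd l k = l := le_antisymm (Nat.gcd_le_left k (Nat.pos_of_ne_zero hl0)) hle
      exact Cardinal.nat_coe_dvd_iff.mpr (heq ▸ Nat.gcd_dvd_right l k)

/-! ### Equations under conjugation and twisting -/

section Equations

variable {R : Type u} {m : ℕ}

/-- The word of the free group obtained from a monomial by dropping the coefficients. -/
def RingMonomial.word (t : RingMonomial R m) : FreeGroup (Fin m) :=
  (t.map fun f => FreeGroup.of f.unknown ^ f.exponent).prod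

theorem RingMonomial.word_cons (f : RingFactor R m) (t : RingMonomial R m) :
    RingMonomial.word (f :: t) = FreeGroup.of f.unknown ^ f.exponent * t.word := by
  simp [RingMonomial.word]

theorem RingMonomial.lift_word {n : ℕ} (t : RingMonomial R m) (deg : Fin m → ZMod n) :
    FreeGroup.lift (fun i => Multiplicative.ofAdd (deg i)) t.word
      = Multiplicative.ofAdd (t.degree deg) := by
  induction t with
  | nil => simp [RingMonomial.word, RingMonomial.degree]
  | cons f t ih =>
    rw [RingMonomial.word_cons, map_mul, ih, map_zpow, FreeGroup.lift_apply_of]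
    simp only [RingMonomial.degree, List.map_cons, List.sum_cons, ofAdd_add, ← ofAdd_zsmul,
      zsmul_eq_mul]

variable [Ring R]

theorem RingMonomial.eval_nil (x : Fin m → Rˣ) : RingMonomial.eval ([] : RingMonomial R m) x = 1 :=
  rfl

theorem RingMonomial.eval_cons (f : RingFactor R m) (t : RingMonomial R m) (x : Fin m → Rˣ) :
    RingMonomial.eval (f :: t) x
      = f.coeff * ((x f.unknown ^ f.exponent : Rˣ) : R) * t.eval x := by
  simp [RingMonomial.eval]

/-- The values of the generators under a homomorphism from the free group to the units. -/
abbrev generatorValues (φ : FreeGroup (Fin m) →* Rˣ) : Fin m → Rˣ := fun i => φ (FreeGroup.of i)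

theorem RingMonomial.eval_conj (t : RingMonomial R m) (φ : FreeGroup (Fin m) →* Rˣ) (u : Rˣ)
    (hu : ∀ f ∈ t, f.coeff * u = u * f.coeff) :
    t.eval (generatorValues ((MulAut.conj u).toMonoidHom.comp φ))
      = u * t.eval (generatorValues φ) * (u⁻¹ : Rˣ) := by
  induction t with
  | nil => simp [RingMonomial.eval_nil]
  | cons f t ih =>
    rw [RingMonomial.eval_cons, RingMonomial.eval_cons, ih fun g hg => hu g (by simp [hg])]
    have h1 : (generatorValues ((MulAut.conj u).toMonoidHom.comp φ) f.unknown) ^ f.exponent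
        = u * generatorValues φ f.unknown ^ f.exponent * u⁻¹ := by
      simp [generatorValues, conj_zpow]
    rw [h1]
    simp only [Units.val_mul, ← mul_assoc]
    rw [hu f (by simp)]
    simp [mul_assoc]

/-- Moving an element of the core from the left to the right of the value of a monomial. -/
theorem RingMonomial.mul_eval {H : Subgroup Rˣ} (t : RingMonomial R m)
    (φ : FreeGroup (Fin m) →* Rˣ) (hH : ∀ f ∈ t, ∀ u ∈ H, f.coeff * (u : Rˣ) = u * f.coeff)
    {u : Rˣ} (hu : u ∈ homCore H φ) :
    u * t.eval (generatorValues φ)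
      = t.eval (generatorValues φ) * ((φ t.word)⁻¹ * u * φ t.word : Rˣ) := by
  induction t generalizing u with
  | nil => simp [RingMonomial.eval_nil, RingMonomial.word]
  | cons f t ih =>
    have h1 : generatorValues φ f.unknown ^ f.exponent = φ (FreeGroup.of f.unknown ^ f.exponent) :=
      (map_zpow φ _ _).symm
    rw [RingMonomial.eval_cons, RingMonomial.word_cons, h1]
    set g := FreeGroup.of f.unknown ^ f.exponent
    -- The conjugate of u stays in the core, hence in H, so it commutes with the remaining
    -- coefficients too.
    have h2 := ih (fun f hf => hH f (by simp [hf])) (inv_conj_mem_homCore hu g)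
    calc (u : R) * (f.coeff * (φ g : Rˣ) * RingMonomial.eval t (generatorValues φ))
        = f.coeff * (φ g : Rˣ) * (((φ g)⁻¹ * u * φ g : Rˣ) * RingMonomial.eval t (generatorValues φ)) := by
          rw [← mul_assoc, ← mul_assoc, ← hH f (by simp) u (homCore_le H φ hu)]
          simp [mul_assoc]
      _ = _ := by
          rw [h2, map_mul]
          simp [mul_assoc]

/-- The effect of a twist on the value of a monomial. -/
theorem RingMonomial.eval_twist {H : Subgroup Rˣ} {N : Subgroup (FreeGroup (Fin m))}
    (t : RingMonomial R m) {φ ψ : FreeGroup (Fin m) →* Rˣ}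
    (hH : ∀ f ∈ t, ∀ u ∈ H, f.coeff * (u : Rˣ) = u * f.coeff) (hφ : TwistRel H N φ ψ) :
    t.eval (generatorValues ψ)
      = t.eval (generatorValues φ) * ((φ t.word)⁻¹ * ψ t.word : Rˣ) := by
  induction t with
  | nil => simp [RingMonomial.eval_nil, RingMonomial.word]
  | cons f t ih =>
    have hH' : ∀ g ∈ t, ∀ u ∈ H, g.coeff * (u : Rˣ) = u * g.coeff :=
      fun g hg => hH g (by simp [hg])
    have h1 : ∀ χ : FreeGroup (Fin m) →* Rˣ, generatorValues χ f.unknown ^ f.exponent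
        = χ (FreeGroup.of f.unknown ^ f.exponent) := fun χ => (map_zpow χ _ _).symm
    rw [RingMonomial.eval_cons, RingMonomial.eval_cons, RingMonomial.word_cons, h1, h1, ih hH']
    set g := FreeGroup.of f.unknown ^ f.exponent
    have h2 := RingMonomial.mul_eval t φ hH' (hφ.2 g)
    calc f.coeff * (ψ g : Rˣ) * (RingMonomial.eval t (generatorValues φ) * ((φ (RingMonomial.word t))⁻¹ * ψ (RingMonomial.word t) : Rˣ))
        = f.coeff * (φ g : Rˣ) * (((φ g)⁻¹ * ψ g : Rˣ) * RingMonomial.eval t (generatorValues φ))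
            * ((φ (RingMonomial.word t))⁻¹ * ψ (RingMonomial.word t) : Rˣ) := by simp [mul_assoc]
      _ = _ := by
          rw [h2, map_mul, map_mul]
          simp [mul_assoc]

theorem RingEquation.eval_conj_eq_zero (e : RingEquation R m) (φ : FreeGroup (Fin m) →* Rˣ)
    (u : Rˣ) (hu : ∀ t ∈ e, ∀ f ∈ t, f.coeff * u = u * f.coeff)
    (h : RingEquation.eval e (generatorValues φ) = 0) :
    RingEquation.eval e (generatorValues ((MulAut.conj u).toMonoidHom.comp φ)) = 0 := by
  have : RingEquation.eval e (generatorValues ((MulAut.conj u).toMonoidHom.comp φ))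
      = u * RingEquation.eval e (generatorValues φ) * (u⁻¹ : Rˣ) := by
    unfold RingEquation.eval
    rw [List.map_congr_left fun t ht => RingMonomial.eval_conj t φ u (hu t ht),
      ← List.sum_map_mul_left, ← List.sum_map_mul_right]
  rw [this, h]
  simp

/-- Since φ and ψ agree on N, the factor φ(w)⁻¹ψ(w) is the same for all monomials and can be taken
out of the sum. -/
theorem RingEquation.eval_twist_eq_zero {H : Subgroup Rˣ} {N : Subgroup (FreeGroup (Fin m))}
    (e : RingEquation R m) {φ ψ : FreeGroup (Fin m) →* Rˣ}
    (hH : ∀ t ∈ e, ∀ f ∈ t, ∀ u ∈ H, f.coeff * (u : Rˣ) = u * f.coeff) (hφ : TwistRel H N φ ψ)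
    (hN : ∀ s ∈ e, ∀ t ∈ e, RingMonomial.word s * (RingMonomial.word t)⁻¹ ∈ N)
    (h : RingEquation.eval e (generatorValues φ) = 0) :
    RingEquation.eval e (generatorValues ψ) = 0 := by
  rcases e with _ | ⟨s, e⟩
  · rfl
  have hw : ∀ t ∈ s :: e, (φ (RingMonomial.word t))⁻¹ * ψ (RingMonomial.word t)
      = (φ s.word)⁻¹ * ψ s.word := by
    intro t ht
    have := hφ.1 _ (hN t ht s (by simp))
    simp only [map_mul, map_inv, mul_inv_eq_iff_eq_mul] at this
    rw [this]
    group
  have : RingEquation.eval (s :: e) (generatorValues ψ)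
      = RingEquation.eval (s :: e) (generatorValues φ) * ((φ s.word)⁻¹ * ψ s.word : Rˣ) := by
    unfold RingEquation.eval
    rw [← List.sum_map_mul_right]
    exact congrArg List.sum (List.map_congr_left fun t ht => by
      rw [RingMonomial.eval_twist t (hH t ht) hφ, hw t ht])
  rw [this, h, zero_mul]

/-- The number of solutions of a system that is homogeneous modulo `n` is divisible by the order of
each subgroup whose order divides `n` and whose elements commute with the coefficients. -/
theorem RingSystem.mk_subgroup_dvd_mk_solutions {S : RingSystem R m} {n : ℕ}
    (hS : S.IsHomogeneousMod n) {G H : Subgroup Rˣ} (hHG : H ≤ G)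
    (hcoeff : ∀ c ∈ S.coeffs, ∀ u ∈ H, c * (u : Rˣ) = u * c) (hH : #H ∣ (n : Cardinal.{u})) :
    #H ∣ #(S.solutions G) := by
  obtain ⟨deg, hdeg, hhom⟩ := hS
  let D : FreeGroup (Fin m) →* Multiplicative (ZMod n) :=
    FreeGroup.lift fun i => Multiplicative.ofAdd (deg i)
  -- The degrees generate ℤ/n, so the free group has an element t of degree 1.
  have hD : ∀ a : ZMod n, ∃ f, D f = Multiplicative.ofAdd a := by
    intro a
    have ha : a ∈ AddSubgroup.closure (Set.range deg) := by rw [hdeg]; trivial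
    induction ha using AddSubgroup.closure_induction with
    | mem a ha =>
      obtain ⟨i, rfl⟩ := ha
      exact ⟨FreeGroup.of i, by simp [D]⟩
    | zero => exact ⟨1, by simp⟩
    | add a b _ _ ha hb =>
      obtain ⟨f, hf⟩ := ha
      obtain ⟨g, hg⟩ := hb
      exact ⟨f * g, by rw [map_mul, hf, hg, ofAdd_add]⟩
    | neg a _ ha =>
      obtain ⟨f, hf⟩ := ha
      exact ⟨f⁻¹, by rw [map_inv, hf, ofAdd_neg]⟩
  obtain ⟨t, ht⟩ := hD 1
  have htk : ∀ k : ℤ, D (t ^ k) = Multiplicative.ofAdd (k : ZMod n) := by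
    intro k
    rw [map_zpow, ht, ← ofAdd_zsmul, zsmul_one]
  have hcomm : ∀ e ∈ S, ∀ t ∈ e, ∀ f ∈ t, ∀ u ∈ H, f.coeff * (u : Rˣ) = u * f.coeff :=
    fun e he t ht f hf => hcoeff _ ⟨e, he, t, ht, f, hf, rfl⟩
  let Φ : Set (FreeGroup (Fin m) →* Rˣ) :=
    {φ | (∀ i, φ (FreeGroup.of i) ∈ G) ∧ ∀ e ∈ S, RingEquation.eval e (generatorValues φ) = 0}
  have hΦ : #(S.solutions G) = #Φ := by
    refine Cardinal.mk_congr
      { toFun := fun x => ⟨FreeGroup.lift fun i => (x.1 i : Rˣ), fun i => ?_, fun e he => ?_⟩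
        invFun := fun φ => ⟨fun i => ⟨φ.1 (FreeGroup.of i), φ.2.1 i⟩, fun e he => φ.2.2 e he⟩
        left_inv := fun x => ?_
        right_inv := fun φ => ?_ }
    · rw [FreeGroup.lift_apply_of]
      exact (x.1 i).2
    · have hx : (generatorValues (FreeGroup.lift fun i => (x.1 i : Rˣ))) = fun i => (x.1 i : Rˣ) :=
        funext fun i => FreeGroup.lift_apply_of
      rw [hx]
      exact x.2 e he
    · exact Subtype.ext (funext fun i => Subtype.ext (by simp))
    · exact Subtype.ext (FreeGroup.ext_hom _ _ fun i => by simp)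
  rw [hΦ]
  refine mk_subgroup_dvd_mk_homs (N := D.ker) (t := t) hH (fun f => ?_) (fun k => ?_) Φ ?_ ?_
  · obtain ⟨k, hk⟩ := ZMod.intCast_surjective (Multiplicative.toAdd (D f))
    refine ⟨k, ?_⟩
    rw [MonoidHom.mem_ker, map_mul, map_inv, htk, hk]
    simp
  · rw [MonoidHom.mem_ker, htk, ofAdd_eq_one, ZMod.intCast_zmod_eq_zero_iff_dvd]
  · rintro u hu φ ⟨h1, h2⟩
    refine ⟨fun i => ?_, fun e he => ?_⟩
    · exact G.mul_mem (G.mul_mem (hHG hu) (h1 i)) (G.inv_mem (hHG hu))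
    · exact RingEquation.eval_conj_eq_zero e φ u (fun t ht f hf => hcomm e he t ht f hf u hu)
        (h2 e he)
  · rintro φ ⟨h1, h2⟩ ψ hψ
    refine ⟨fun i => ?_, fun e he => ?_⟩
    · have := G.mul_mem (h1 i) (hHG (homCore_le H φ (hψ.2 (FreeGroup.of i))))
      simpa using this
    · refine RingEquation.eval_twist_eq_zero e (hcomm e he) hψ (fun r hr s hs => ?_) (h2 e he)
      obtain ⟨d, hd⟩ := hhom e he
      rw [MonoidHom.mem_ker, map_mul, map_inv]
      change D _ * (D _)⁻¹ = 1
      simp only [D]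
      rw [RingMonomial.lift_word, RingMonomial.lift_word, hd r hr, hd s hs, mul_inv_cancel]

end Equations

theorem theorem3 {R : Type u} [Ring R] (G : Subgroup Rˣ) (m : ℕ) (S : RingSystem R m) :
    groupGCD (G ⊓ (Submonoid.centralizer S.coeffs).units : Subgroup Rˣ) S.homogeneityModulus ∣
      Cardinal.mk (S.solutions G) := by
  refine groupGCD_dvd fun H hH => ?_
  have hmk : #H = #(H.map (Subgroup.subtype _)) :=
    Cardinal.mk_congr (H.equivMapOfInjective _ (Subgroup.subtype_injective _)).toEquiv
  have hle : H.map (Subgroup.subtype _) ≤ G ⊓ (Submonoid.centralizer S.coeffs).units :=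
    Subgroup.map_subtype_le H
  rw [hmk] at hH ⊢
  refine RingSystem.mk_subgroup_dvd_mk_solutions S.isHomogeneousMod_homogeneityModulus
    (hle.trans inf_le_left) (fun c hc u hu => ?_) hH
  exact Submonoid.mem_centralizer_iff.mp ((Submonoid.mem_units_iff _ _).mp (hle hu).2).1 c hc
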